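/- **Theorem 3.** For a function $\sigma:\mathbb{R}\to\mathbb{R}$ (applied entrywise to vectors), let \[ \mathcal{F}^{\sigma}_{b,B,n,d}=\left\{\mathbf{x}\mapsto \mathbf{u}^\top\sigma(W\mathbf{x})~:~\mathbf{u}\in\mathbb{R}^n,~W\in\mathbb{R}^{n\times d},~\|\mathbf{u}\|\le b,~\|W\|_F\le B\right\}, \] where $\|\cdot\|$ is the Euclidean norm and $\|\cdot\|_F$ the Frobenius norm. A class $\mathcal{F}$ of real functions shatters the points $\mathbf{x}_1,\dots,\mathbf{x}_m$ with margin $\epsilon$ if there is a number $s$ such that for every $\mathbf{y}\in\{0,1\}^m$ there is $f\in\mathcal{F}$ with, for all $i$, $f(\mathbf{x}_i)\le s-\epsilon$ if $y_i=0$ and $f(\mathbf{x}_i)\ge s+\epsilon$ if $y_i=1$. For $b,B,b_x,\epsilon>0$ and integers $n,d\ge 1$ let $\Lambda=\log\left(2+d+n+b+B+b_x+\tfrac1\epsilon\right)$. There are universal constants $C_1,C_2,c>0$ and $k_1,k_2,d_0\in\mathbb{N}$ such that the following holds for all $b,B,b_x,\epsilon>0$ and all integers $n\ge 1$ and $d\ge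 \max\{d_0,1\}$. Put \[ M=\frac{1}{C_1\Lambda^{k_1}}\min\left\{nd,~\frac{bBb_x}{\epsilon}\sqrt{d}\right\}, \] and assume $M>cd$. Then there is a bias \[ 0\le\beta\le C_2\Lambda^{k_2}\,\frac{Bb_x}{\sqrt{dn}} \] such that, for the activation $\sigma(z)=[z-\beta]_+=\max\{z-\beta,0\}$, the class $\mathcal{F}^{\sigma}_{b,B,n,d}$ shatters, with margin $\epsilon$, some $m\ge M$ distinct points of $\{\mathbf{x}\in\mathbb{R}^d:\|\mathbf{x}\|\le b_x\}$. -/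

import Mathlib

open scoped Matrix

/-- The Frobenius norm `√(∑ M_{ij}²)` of a real matrix. -/
noncomputable def frobNorm {n d : ℕ} (M : Matrix (Fin n) (Fin d) ℝ) : ℝ :=
  Real.sqrt (∑ i, ∑ j, M i j ^ 2)

/-- The one-hidden-layer network `x ↦ uᵀ σ(W x)`, with `σ` applied entrywise. -/
noncomputable def network {n d : ℕ} (σ : ℝ → ℝ) (u : EuclideanSpace ℝ (Fin n))
    (W : Matrix (Fin n) (Fin d) ℝ) (x : EuclideanSpace ℝ (Fin d)) : ℝ :=
  ∑ k, u k * σ ((W *ᵥ (fun j => x j)) k)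

/-- The class of width-`n` networks on `ℝ^d` with `‖u‖ ≤ b` (Euclidean norm) and
`‖W‖_F ≤ B`. -/
def frobClass (σ : ℝ → ℝ) (b B : ℝ) (n d : ℕ) : Set (EuclideanSpace ℝ (Fin d) → ℝ) :=
  {f | ∃ (u : EuclideanSpace ℝ (Fin n)) (W : Matrix (Fin n) (Fin d) ℝ),
    ‖u‖ ≤ b ∧ frobNorm W ≤ B ∧ f = network σ u W}

/-- The class `F` shatters the `m` points `x₁, …, x_m` with margin `ε`; the level `s` is common to
all points and all labellings. -/
def ShattersWithMargin {X : Type*} (F : Set (X → ℝ)) {m : ℕ} (x : Fin m → X) (ε : ℝ) : Prop :=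
  ∃ s : ℝ, ∀ y : Fin m → Bool, ∃ f ∈ F, ∀ i,
    (y i = false → f (x i) ≤ s - ε) ∧ (y i = true → s + ε ≤ f (x i))

/-- The ReLU with bias, `z ↦ [z - β]₊`. -/
noncomputable def biasedReLU (β : ℝ) (z : ℝ) : ℝ := max (z - β) 0

/-- The logarithmic scale of the parameters. A factor polylogarithmic in `d, n, b, B, b_x, 1/ε` is
one that is bounded by `C * logScale ^ k` for universal `C` and `k`. -/
noncomputable def logScale (d n : ℕ) (b B bx ε : ℝ) : ℝ :=
  Real.log (2 + d + n + b + B + bx + 1 / ε)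

/-- The quantity `min {n d, (b B b_x / ε) √d}` with constant `C` and logarithmic factor
`logScale ^ k` divided out. -/
noncomputable def shatterBound (C : ℝ) (k : ℕ) (d n : ℕ) (b B bx ε : ℝ) : ℝ :=
  min ((n : ℝ) * d) (b * B * bx / ε * Real.sqrt d) / (C * logScale d n b B bx ε ^ k)

/-- The vector `v`, indexed by the points `x`, is a combination of the ReLU features of unit
weight vectors, indexed by `K`, with total absolute coefficient at most `T`. -/
def ReluRep {P I : Type*} [Fintype I] (K : Type*) [Fintype K] (x : P → I → ℝ) (T : ℝ)
    (v : P → ℝ) : Prop :=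
  ∃ (a : K → ℝ) (w : K → I → ℝ), (∀ k, ∑ j, w k j ^ 2 ≤ 1) ∧ ∑ k, |a k| ≤ T ∧
    ∀ p, v p = ∑ k, a k * max (w k ⬝ᵥ x p) 0

theorem sum_extend_eq {ι κ E F : Type*} [Fintype ι] [Fintype κ] [AddCommMonoid F] (e : ι ↪ κ)
    (v : ι → E) (z : κ → E) (G : κ → E → F) (hG : ∀ k, G k (z k) = 0) :
    ∑ k, G k (Function.extend e v z k) = ∑ i, G (e i) (v i) := by
  symm
  refine Fintype.sum_of_injective e e.injective _ _ (fun k hk => ?_) (fun i => ?_)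
  · rw [Function.extend_apply' _ _ _ (by simpa using hk)]
    exact hG k
  · rw [e.injective.extend_apply]

theorem extend_dotProduct {ι κ : Type*} [Fintype ι] [Fintype κ] (e : ι ↪ κ) (v w : ι → ℝ) :
    Function.extend e v 0 ⬝ᵥ Function.extend e w 0 = v ⬝ᵥ w := by
  unfold dotProduct
  rw [sum_extend_eq e v 0 (fun k t => t * Function.extend e w 0 k) (by simp)]
  simp [e.injective.extend_apply]

theorem sum_extend_sq {ι κ : Type*} [Fintype ι] [Fintype κ] (e : ι ↪ κ) (v : ι → ℝ) :
    ∑ k, Function.extend e v 0 k ^ 2 = ∑ i, v i ^ 2 :=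
  sum_extend_eq e v 0 (fun _ t => t ^ 2) (by simp)

/-- A vector with a cheap representation by ReLU features is realised by a network, when all points
share a constant coordinate through which the bias can be absorbed. -/
theorem ReluRep.exists_network {P I K : Type*} [Fintype I] [Fintype K] {d n : ℕ} (e : I ↪ Fin d)
    (hK : Fintype.card K ≤ n) {x : P → I → ℝ} {i₀ : I} {κ : ℝ} (hκ : 0 < κ)
    (hx : ∀ p, x p i₀ = κ) {b B β : ℝ} (hb : 0 < b) (hB : 0 < B)
    (hβB : 4 * n * β ^ 2 ≤ κ ^ 2 * B ^ 2) {v : P → ℝ} (h : ReluRep K x (b * B / 2) v) :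
    ∃ f ∈ frobClass (biasedReLU β) b B n d,
      ∀ p, f (WithLp.toLp 2 (Function.extend e (x p) 0)) = v p := by
  classical
  obtain ⟨a, w, hw, ha, hv⟩ := h
  obtain ⟨f⟩ : Nonempty (K ↪ Fin n) :=
    Function.Embedding.nonempty_of_card_le (by simpa using hK)
  set l : ℝ := Real.sqrt (2 * b / B) with hl
  have hl0 : 0 < l := Real.sqrt_pos.2 (by positivity)
  have hl2 : l ^ 2 = 2 * b / B := Real.sq_sqrt (by positivity)
  set u₀ : K → ℝ := fun k => l * (SignType.sign (a k) * Real.sqrt |a k|) with hu₀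
  set W₀ : K → I → ℝ := fun k j =>
    Real.sqrt |a k| / l * w k j + if j = i₀ then β / κ else 0 with hW₀
  have hu₀sq : ∀ k, u₀ k ^ 2 ≤ 2 * b / B * |a k| := by
    intro k
    have h1 : ((SignType.sign (a k) : SignType) : ℝ) ^ 2 ≤ 1 := by
      rcases lt_trichotomy (a k) 0 with h | h | h <;> simp [h]
    simp only [hu₀]
    rw [mul_pow, mul_pow, hl2, Real.sq_sqrt (abs_nonneg _)]
    have : 0 ≤ 2 * b / B * |a k| := by positivity
    nlinarith
  have hW₀sq : ∀ k, ∑ j, W₀ k j ^ 2 ≤ B / b * |a k| + 2 * (β / κ) ^ 2 := by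
    intro k
    calc ∑ j, W₀ k j ^ 2
        ≤ ∑ j, (2 * (Real.sqrt |a k| / l * w k j) ^ 2
            + 2 * (if j = i₀ then β / κ else 0) ^ 2) := by
          refine Finset.sum_le_sum fun j _ => ?_
          simp only [hW₀]
          linarith [add_sq_le (a := Real.sqrt |a k| / l * w k j)
            (b := if j = i₀ then β / κ else 0)]
      _ = 2 * (|a k| / (2 * b / B)) * ∑ j, w k j ^ 2 + 2 * (β / κ) ^ 2 := by
          rw [Finset.sum_add_distrib, ← Finset.mul_sum, ← Finset.mul_sum]
          simp only [mul_pow, ← Finset.mul_sum, ite_pow]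
          simp [div_pow, Real.sq_sqrt (abs_nonneg (a k)), hl2]
          ring
      _ ≤ 2 * (|a k| / (2 * b / B)) * 1 + 2 * (β / κ) ^ 2 := by
          gcongr
          exact hw k
      _ = _ := by field_simp
  refine ⟨_, ⟨WithLp.toLp 2 (Function.extend f u₀ 0),
    Matrix.of (Function.extend f (fun k => Function.extend e (W₀ k) 0) 0), ?_, ?_, rfl⟩, ?_⟩
  · rw [EuclideanSpace.norm_eq]
    refine Real.sqrt_le_iff.2 ⟨hb.le, ?_⟩
    simp only [Real.norm_eq_abs, sq_abs]
    rw [sum_extend_sq]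
    calc ∑ k, u₀ k ^ 2 ≤ ∑ k, 2 * b / B * |a k| := Finset.sum_le_sum fun k _ => hu₀sq k
      _ = 2 * b / B * ∑ k, |a k| := by rw [Finset.mul_sum]
      _ ≤ 2 * b / B * (b * B / 2) := by gcongr
      _ = b ^ 2 := by field_simp
  · refine Real.sqrt_le_iff.2 ⟨hB.le, ?_⟩
    simp only [Matrix.of_apply]
    rw [sum_extend_eq f (fun k => Function.extend e (W₀ k) 0) 0 (fun _ t => ∑ j, t j ^ 2)
      (by simp)]
    simp only [sum_extend_sq]
    calc ∑ k, ∑ j, W₀ k j ^ 2 ≤ ∑ k, (B / b * |a k| + 2 * (β / κ) ^ 2) :=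
          Finset.sum_le_sum fun k _ => hW₀sq k
      _ = B / b * ∑ k, |a k| + Fintype.card K * (2 * (β / κ) ^ 2) := by
          rw [Finset.sum_add_distrib, ← Finset.mul_sum]
          simp
      _ ≤ B / b * (b * B / 2) + n * (2 * (β / κ) ^ 2) := by gcongr
      _ = B ^ 2 / 2 + (4 * n * β ^ 2) / (2 * κ ^ 2) := by field_simp; ring
      _ ≤ B ^ 2 / 2 + (κ ^ 2 * B ^ 2) / (2 * κ ^ 2) := by gcongr
      _ = B ^ 2 := by field_simp; ring
  · intro p
    unfold network Matrix.mulVec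
    simp only [Matrix.of_apply]
    have key : ∀ k, W₀ k ⬝ᵥ x p = Real.sqrt |a k| / l * (w k ⬝ᵥ x p) + β := by
      intro k
      simp only [hW₀, dotProduct, add_mul, Finset.sum_add_distrib, mul_assoc, ← Finset.mul_sum]
      simp [hx p]
      field_simp
    rw [sum_extend_eq f u₀ 0 (fun k t => t * biasedReLU β
      (Function.extend f (fun k => Function.extend e (W₀ k) 0) 0 k ⬝ᵥ
        (fun j => Function.extend e (x p) 0 j))) (by simp), hv p]
    refine Finset.sum_congr rfl fun k _ => ?_
    rw [f.injective.extend_apply]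
    change u₀ k * biasedReLU β (Function.extend e (W₀ k) 0 ⬝ᵥ Function.extend e (x p) 0) = _
    rw [extend_dotProduct, key, biasedReLU, add_sub_cancel_right]
    have hs : 0 ≤ Real.sqrt |a k| / l := by positivity
    have h0 : max (Real.sqrt |a k| / l * (w k ⬝ᵥ x p)) 0
        = Real.sqrt |a k| / l * max (w k ⬝ᵥ x p) 0 := by
      rw [mul_max_of_nonneg _ _ hs, mul_zero]
    rw [h0]
    have h1 : u₀ k * (Real.sqrt |a k| / l) = a k := by
      simp only [hu₀]
      calc l * (SignType.sign (a k) * Real.sqrt |a k|) * (Real.sqrt |a k| / l)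
          = SignType.sign (a k) * (Real.sqrt |a k| * Real.sqrt |a k|) := by field_simp
        _ = a k := by rw [Real.mul_self_sqrt (abs_nonneg _)]; exact sign_mul_abs _
    rw [← mul_assoc, h1]

/-- Shattering from cheap representations by ReLU features of two-valued vectors. -/
theorem shatters_of_reluRep {P I K : Type*} [Fintype P] [Fintype I] [Fintype K] {d n : ℕ}
    (hI : Fintype.card I ≤ d) (hK : Fintype.card K ≤ n) {x : P → I → ℝ}
    (hinj : Function.Injective x) {i₀ : I} {κ : ℝ} (hκ : 0 < κ)
    (hx : ∀ p, x p i₀ = κ) {b B β bx ε s : ℝ} (hb : 0 < b) (hB : 0 < B) (hbx : 0 ≤ bx)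
    (hnorm : ∀ p, ∑ i, x p i ^ 2 ≤ bx ^ 2)
    (hβB : 4 * n * β ^ 2 ≤ κ ^ 2 * B ^ 2)
    (h : ∀ y : P → Bool, ReluRep K x (b * B / 2) (fun p => if y p then s + ε else s - ε)) :
    ∃ z : Fin (Fintype.card P) → EuclideanSpace ℝ (Fin d),
      Function.Injective z ∧ (∀ i, ‖z i‖ ≤ bx) ∧
      ShattersWithMargin (frobClass (biasedReLU β) b B n d) z ε := by
  obtain ⟨e⟩ : Nonempty (I ↪ Fin d) :=
    Function.Embedding.nonempty_of_card_le (by simpa using hI)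
  let eP := Fintype.equivFin P
  refine ⟨fun i => WithLp.toLp 2 (Function.extend e (x (eP.symm i)) 0), ?_, ?_, s, ?_⟩
  · intro i j hij
    have h1 : Function.extend e (x (eP.symm i)) 0 = Function.extend e (x (eP.symm j)) 0 :=
      congrArg WithLp.ofLp hij
    exact eP.symm.injective (hinj (Function.extend_injective e.injective 0 h1))
  · intro i
    rw [EuclideanSpace.norm_eq]
    refine Real.sqrt_le_iff.2 ⟨hbx, ?_⟩
    simp only [Real.norm_eq_abs, sq_abs]
    rw [sum_extend_sq]
    exact hnorm _
  · intro y
    obtain ⟨f, hf, hfv⟩ := (h (fun p => y (eP p))).exists_network e hK hκ hx hb hB hβB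
    refine ⟨f, hf, fun i => ⟨fun hy => ?_, fun hy => ?_⟩⟩
    · rw [hfv]; simp [hy]
    · rw [hfv]; simp [hy]

theorem reluRep_of_sum {P I K : Type*} [Fintype I] [Fintype K] {x : P → I → ℝ} {ρ : ℝ}
    (hρ : 0 < ρ) {v : P → ℝ} (a : K → ℝ) (w : K → I → ℝ) (hw : ∀ k, ∑ j, w k j ^ 2 ≤ ρ ^ 2)
    (hv : ∀ p, v p = ∑ k, a k * max (w k ⬝ᵥ x p) 0) : ReluRep K x (ρ * ∑ k, |a k|) v := by
  refine ⟨fun k => ρ * a k, fun k => ρ⁻¹ • w k, fun k => ?_, ?_, fun p => ?_⟩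
  · simp only [Pi.smul_apply, smul_eq_mul, mul_pow, ← Finset.mul_sum]
    rw [inv_pow, inv_mul_le_iff₀ (by positivity), mul_one]
    exact hw k
  · simp only [abs_mul, abs_of_pos hρ, ← Finset.mul_sum, le_refl]
  · rw [hv p]
    refine Finset.sum_congr rfl fun k _ => ?_
    have : max (ρ⁻¹ • w k ⬝ᵥ x p) 0 = ρ⁻¹ * max (w k ⬝ᵥ x p) 0 := by
      rw [smul_dotProduct, smul_eq_mul, mul_max_of_nonneg _ _ (by positivity), mul_zero]
    rw [this]
    field_simp

theorem ReluRep.mono {P I K L : Type*} [Fintype I] [Fintype K] [Fintype L] {x : P → I → ℝ}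
    {T T' : ℝ} {v : P → ℝ} (h : ReluRep K x T v) (hT : T ≤ T')
    (hKL : Fintype.card K ≤ Fintype.card L) : ReluRep L x T' v := by
  obtain ⟨f⟩ := Function.Embedding.nonempty_of_card_le hKL
  obtain ⟨a, w, hw, ha, hv⟩ := h
  refine ⟨Function.extend f a 0, Function.extend f w 0, fun l => ?_, ?_, fun p => ?_⟩
  · by_cases hl : ∃ k, f k = l
    · obtain ⟨k, rfl⟩ := hl
      rw [f.injective.extend_apply]
      exact hw k
    · rw [Function.extend_apply' _ _ _ hl]
      simp
  · rw [sum_extend_eq f a 0 (fun _ t => |t|) (by simp)]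
    exact ha.trans hT
  · rw [sum_extend_eq f a 0 (fun l t => t * max (Function.extend f w 0 l ⬝ᵥ x p) 0) (by simp), hv p]
    simp only [f.injective.extend_apply]

theorem ReluRep.const_mul {P I K : Type*} [Fintype I] [Fintype K] {x : P → I → ℝ} {T : ℝ}
    {v : P → ℝ} (h : ReluRep K x T v) {c : ℝ} (hc : 0 ≤ c) :
    ReluRep K x (c * T) (fun p => c * v p) := by
  obtain ⟨a, w, hw, ha, hv⟩ := h
  refine ⟨fun k => c * a k, w, hw, ?_, fun p => ?_⟩
  · simp only [abs_mul, abs_of_nonneg hc, ← Finset.mul_sum]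
    gcongr
  · simp only [hv p, Finset.mul_sum, mul_assoc]

/-- Carathéodory's theorem: no more features are needed than there are points, plus one. -/
theorem ReluRep.caratheodory {P I K : Type*} [Fintype P] [Fintype I] [Fintype K]
    {x : P → I → ℝ} {T : ℝ} {v : P → ℝ} (h : ReluRep K x T v) :
    ReluRep (Fin (Fintype.card P + 1)) x T v := by
  obtain ⟨a, w, hw, ha, hv⟩ := h
  rcases (Finset.sum_nonneg fun k (_ : k ∈ Finset.univ) => abs_nonneg (a k)).eq_or_lt with h0 | h0
  · have ha0 : ∀ k, a k = 0 := fun k => abs_eq_zero.1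
      ((Finset.sum_eq_zero_iff_of_nonneg fun k _ => abs_nonneg (a k)).1 h0.symm k
        (Finset.mem_univ k))
    refine ⟨0, 0, fun _ => by simp, by simpa using h0.trans_le ha, fun p => ?_⟩
    rw [hv p]
    simp [ha0]
  set S : ℝ := ∑ k, |a k| with hS
  set φ : K → P → ℝ := fun k p => SignType.sign (a k) * max (w k ⬝ᵥ x p) 0 with hφ
  have hmem : S⁻¹ • v ∈ convexHull ℝ (Set.range φ) := by
    have h1 : S⁻¹ • v = ∑ k, (S⁻¹ * |a k|) • φ k := by
      ext p
      simp only [Pi.smul_apply, Finset.sum_apply, smul_eq_mul, hv p, Finset.mul_sum, hφ]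
      refine Finset.sum_congr rfl fun k _ => ?_
      nth_rewrite 1 [← sign_mul_abs (a k)]
      ring
    rw [h1]
    refine (convex_convexHull ℝ _).sum_mem (fun k _ => by positivity) ?_
      (fun k _ => subset_convexHull ℝ _ ⟨k, rfl⟩)
    rw [← Finset.mul_sum, ← hS, inv_mul_cancel₀ h0.ne']
  obtain ⟨ι, _, z, c, hz, hind, hc, hc1, hcz⟩ := eq_pos_convex_span_of_mem_convexHull hmem
  have hcard : Fintype.card ι ≤ Fintype.card P + 1 := by
    refine hind.card_le_finrank_succ.trans ?_
    have := Submodule.finrank_le (vectorSpan ℝ (Set.range z))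
    rw [Module.finrank_fintype_fun_eq_card] at this
    omega
  choose κ hκ using fun i => hz ⟨i, rfl⟩
  have hrep : ReluRep ι x T v := by
    refine ⟨fun i => S * c i * SignType.sign (a (κ i)), fun i => w (κ i), fun i => hw _, ?_,
      fun p => ?_⟩
    · refine le_trans ?_ ha
      calc ∑ i, |S * c i * SignType.sign (a (κ i))| ≤ ∑ i, S * c i := by
            refine Finset.sum_le_sum fun i _ => ?_
            have h2 : |((SignType.sign (a (κ i)) : SignType) : ℝ)| ≤ 1 := by
              rcases lt_trichotomy (a (κ i)) 0 with h | h | h <;> simp [h]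
            have h3 : 0 ≤ S * c i := mul_nonneg h0.le (hc i).le
            rw [abs_mul, abs_of_nonneg h3]
            nlinarith
        _ = S := by rw [← Finset.mul_sum, hc1, mul_one]
    · have h4 : v p = S * (S⁻¹ • v) p := by
        simp [h0.ne']
      rw [h4, ← hcz, Finset.sum_apply, Finset.mul_sum]
      refine Finset.sum_congr rfl fun i _ => ?_
      rw [← hκ i]
      simp only [hφ, Pi.smul_apply, smul_eq_mul]
      ring
  exact hrep.mono le_rfl (by simpa using hcard)

theorem sum_pow_mul_conj_pow {N : ℕ} {ω : ℂ} (hω : IsPrimitiveRoot ω N) (hω1 : ‖ω‖ = 1)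
    (s t : Fin N) :
    ∑ j : Fin N, ω ^ ((j : ℕ) * s) * (starRingEnd ℂ) (ω ^ ((j : ℕ) * t)) =
      if s = t then (N : ℂ) else 0 := by
  set ζ : ℂ := ω ^ (s : ℕ) * (starRingEnd ℂ) (ω ^ (t : ℕ)) with hζ
  have hconj : ∀ k : ℕ, ω ^ k * (starRingEnd ℂ) (ω ^ k) = 1 := by
    intro k
    rw [Complex.mul_conj']
    simp [hω1]
  have h1 : ∀ j : Fin N, ω ^ ((j : ℕ) * s) * (starRingEnd ℂ) (ω ^ ((j : ℕ) * t)) = ζ ^ (j : ℕ) := by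
    intro j
    simp only [hζ, map_pow]
    ring
  rw [Finset.sum_congr rfl fun j _ => h1 j, Fin.sum_univ_eq_sum_range (fun j => ζ ^ j)]
  split_ifs with h
  · have : ζ = 1 := by rw [hζ, h, hconj]
    simp [this]
  · have hne : ζ ≠ 1 := by
      intro h2
      refine h (Fin.ext (hω.pow_inj s.2 t.2 ?_))
      calc ω ^ (s : ℕ) = ω ^ (s : ℕ) * (ω ^ (t : ℕ) * (starRingEnd ℂ) (ω ^ (t : ℕ))) := by
            rw [hconj, mul_one]
        _ = ζ * ω ^ (t : ℕ) := by rw [hζ]; ring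
        _ = ω ^ (t : ℕ) := by rw [h2, one_mul]
    have hN : ζ ^ N = 1 := by
      rw [hζ, mul_pow, ← map_pow, pow_right_comm ω s N, pow_right_comm ω t N, hω.pow_eq_one]
      simp
    rw [geom_sum_eq hne, hN]
    simp

theorem sum_pow_mul_conj_pow_pi {D N : ℕ} {ω : ℂ} (hω : IsPrimitiveRoot ω N) (hω1 : ‖ω‖ = 1)
    (s t : Fin D → Fin N) :
    ∑ ξ : Fin D → Fin N, ω ^ (∑ i, (ξ i : ℕ) * s i) *
        (starRingEnd ℂ) (ω ^ (∑ i, (ξ i : ℕ) * t i)) =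
      if s = t then (N : ℂ) ^ D else 0 := by
  have h1 : ∀ ξ : Fin D → Fin N, ω ^ (∑ i, (ξ i : ℕ) * s i) *
        (starRingEnd ℂ) (ω ^ (∑ i, (ξ i : ℕ) * t i)) =
      ∏ i, ω ^ ((ξ i : ℕ) * s i) * (starRingEnd ℂ) (ω ^ ((ξ i : ℕ) * t i)) := by
    intro ξ
    rw [← Finset.prod_pow_eq_pow_sum, ← Finset.prod_pow_eq_pow_sum, map_prod,
      Finset.prod_mul_distrib]
  rw [Finset.sum_congr rfl fun ξ _ => h1 ξ, ← Fintype.prod_sum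
    (fun i (j : Fin N) => ω ^ ((j : ℕ) * s i) * (starRingEnd ℂ) (ω ^ ((j : ℕ) * t i)))]
  simp only [sum_pow_mul_conj_pow hω hω1]
  split_ifs with h
  · simp [h]
  · obtain ⟨i, hi⟩ := Function.ne_iff.1 h
    exact Finset.prod_eq_zero (Finset.mem_univ i) (by simp [hi])

/-- Fourier expansion on a grid of a sign vector, with the bound on the absolute sum of the
coefficients that Parseval's identity gives. -/
theorem exists_fourier_coeff {D N : ℕ} (hN : 0 < N) {ω : ℂ} (hω : IsPrimitiveRoot ω N)
    (hω1 : ‖ω‖ = 1) (y : (Fin D → Fin N) → ℝ) (hy : ∀ z, y z ^ 2 = 1) :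
    ∃ c : (Fin D → Fin N) → ℂ, (∑ ξ, ‖c ξ‖) ^ 2 ≤ (N : ℝ) ^ D ∧
      ∀ z, y z = ∑ ξ, (c ξ * ω ^ (∑ i, (ξ i : ℕ) * z i)).re := by
  set E : (Fin D → Fin N) → (Fin D → Fin N) → ℂ := fun ξ z => ω ^ (∑ i, (ξ i : ℕ) * z i) with hE
  have horth : ∀ s t, ∑ ξ, E ξ s * (starRingEnd ℂ) (E ξ t) = if s = t then (N : ℂ) ^ D else 0 :=
    sum_pow_mul_conj_pow_pi hω hω1
  have hN0 : (N : ℂ) ^ D ≠ 0 := pow_ne_zero _ (by exact_mod_cast hN.ne')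
  set c : (Fin D → Fin N) → ℂ := fun ξ =>
    ((N : ℂ) ^ D)⁻¹ * ∑ z, (y z : ℂ) * (starRingEnd ℂ) (E ξ z) with hc
  have hinv : ∀ z, (y z : ℂ) = ∑ ξ, c ξ * E ξ z := by
    intro z
    symm
    calc ∑ ξ, c ξ * E ξ z
        = ((N : ℂ) ^ D)⁻¹ * ∑ t, (y t : ℂ) * ∑ ξ, E ξ z * (starRingEnd ℂ) (E ξ t) := by
          simp only [hc, Finset.mul_sum, Finset.sum_mul]
          rw [Finset.sum_comm]
          refine Finset.sum_congr rfl fun t _ => Finset.sum_congr rfl fun ξ _ => ?_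
          ring
      _ = (y z : ℂ) := by
          simp only [horth]
          simp
          field_simp
  have hpars : ∑ ξ, ‖c ξ‖ ^ 2 = 1 := by
    have hC : (∑ ξ, (c ξ) * (starRingEnd ℂ) (c ξ)) = 1 := by
      calc ∑ ξ, c ξ * (starRingEnd ℂ) (c ξ)
          = ((N : ℂ) ^ D)⁻¹ * ∑ z, (y z : ℂ) * ∑ ξ, c ξ * E ξ z := by
            have : ∀ ξ, (starRingEnd ℂ) (c ξ) = ((N : ℂ) ^ D)⁻¹ * ∑ z, (y z : ℂ) * E ξ z := by
              intro ξ
              simp [hc]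
            simp only [this, Finset.mul_sum]
            rw [Finset.sum_comm]
            refine Finset.sum_congr rfl fun t _ => Finset.sum_congr rfl fun ξ _ => ?_
            ring
        _ = 1 := by
            simp only [← hinv]
            have : ∀ z, (y z : ℂ) * y z = 1 := fun z => by
              rw [← sq]; exact_mod_cast hy z
            simp [this, hN0]
    have h2 : ((∑ ξ, ‖c ξ‖ ^ 2 : ℝ) : ℂ) = 1 := by
      rw [← hC]
      push_cast
      exact Finset.sum_congr rfl fun ξ _ => (Complex.mul_conj' _).symm
    exact_mod_cast h2
  refine ⟨c, ?_, fun z => ?_⟩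
  · refine sq_sum_le_card_mul_sum_sq.trans ?_
    rw [hpars]
    simp
  · rw [← Complex.re_sum, ← hinv z, Complex.ofReal_re]

/-- Discrete second-order Taylor expansion. -/
theorem eq_sum_second_diff (g : ℕ → ℝ) {R j : ℕ} (hj : j ≤ R) :
    g j = g 0 + (g 1 - g 0) * j +
      ∑ k : Fin R, (g (k + 2) - 2 * g (k + 1) + g k) * max ((j : ℝ) - (k + 1)) 0 := by
  have h1 : ∑ k : Fin R, (g (k + 2) - 2 * g (k + 1) + g k) * max ((j : ℝ) - (k + 1)) 0 =
      ∑ k ∈ Finset.range j, (g (k + 2) - 2 * g (k + 1) + g k) * ((j : ℝ) - (k + 1)) := by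
    rw [Fin.sum_univ_eq_sum_range
      (fun k => (g (k + 2) - 2 * g (k + 1) + g k) * max ((j : ℝ) - (k + 1)) 0)]
    symm
    rw [← Finset.sum_subset (Finset.range_mono hj)]
    · refine Finset.sum_congr rfl fun k hk => ?_
      have : (k : ℝ) + 1 ≤ j := by exact_mod_cast Finset.mem_range.1 hk
      rw [max_eq_left (by linarith)]
    · intro k _ hk
      have : (j : ℝ) ≤ k := by exact_mod_cast not_lt.1 (fun h => hk (Finset.mem_range.2 h))
      rw [max_eq_right (by linarith), mul_zero]
  have h2 : ∀ j : ℕ, ∑ k ∈ Finset.range j, (g (k + 2) - 2 * g (k + 1) + g k) =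
      g (j + 1) - g j - (g 1 - g 0) := by
    intro j
    induction j with
    | zero => simp
    | succ j ih => rw [Finset.sum_range_succ, ih]; ring
  have h3 : ∀ j : ℕ, ∑ k ∈ Finset.range j, (g (k + 2) - 2 * g (k + 1) + g k) *
      ((j : ℝ) - (k + 1)) = g j - g 0 - (g 1 - g 0) * j := by
    intro j
    induction j with
    | zero => simp
    | succ j ih =>
      have : ∀ k : ℕ, (g (k + 2) - 2 * g (k + 1) + g k) * (((j + 1 : ℕ) : ℝ) - (k + 1)) =
          (g (k + 2) - 2 * g (k + 1) + g k) * ((j : ℝ) - (k + 1)) +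
            (g (k + 2) - 2 * g (k + 1) + g k) := by
        intro k; push_cast; ring
      simp only [this]
      rw [Finset.sum_add_distrib, h2, Finset.sum_range_succ, ih]
      push_cast
      ring
  rw [h1, h3]
  ring

/-- The points of the grid `{0, 1/N, …, (N - 1)/N}⁴` with a constant coordinate adjoined, scaled
into the ball of radius `bx`. -/
noncomputable def gridPoint (N : ℕ) (bx : ℝ) (z : Fin 4 → Fin N) : Option (Fin 4) → ℝ
  | none => bx / 3
  | some i => bx / 3 * ((z i : ℕ) / N)

theorem gridPoint_injective {N : ℕ} {bx : ℝ} (hN : 0 < N) (hbx : 0 < bx) :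
    Function.Injective (gridPoint N bx) := by
  intro z z' h
  ext i
  have h1 := congrFun h (some i)
  simp only [gridPoint] at h1
  have hN' : (0 : ℝ) < N := by exact_mod_cast hN
  field_simp at h1
  exact_mod_cast h1

theorem sum_gridPoint_sq_le {N : ℕ} {bx : ℝ} (hN : 0 < N) (z : Fin 4 → Fin N) :
    ∑ i, gridPoint N bx z i ^ 2 ≤ bx ^ 2 := by
  have hN' : (0 : ℝ) < N := by exact_mod_cast hN
  have h1 : ∀ i : Fin 4, gridPoint N bx z (some i) ^ 2 ≤ (bx / 3) ^ 2 := by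
    intro i
    simp only [gridPoint, mul_pow]
    have h2 : ((z i : ℕ) / N : ℝ) ≤ 1 := by
      rw [div_le_one hN']
      exact_mod_cast (z i).2.le
    have h3 : (0 : ℝ) ≤ (z i : ℕ) / N := by positivity
    have h4 : ((z i : ℕ) / N : ℝ) ^ 2 ≤ 1 := pow_le_one₀ h3 h2
    nlinarith [sq_nonneg (bx / 3)]
  rw [Fintype.sum_option]
  calc _ ≤ (bx / 3) ^ 2 + ∑ i : Fin 4, (bx / 3) ^ 2 := by
        refine add_le_add le_rfl (Finset.sum_le_sum fun i _ => h1 i)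
    _ ≤ bx ^ 2 := by
        simp
        nlinarith [sq_nonneg bx]

/-- Every sign vector on the grid is a combination of ReLU features whose cost is proportional to
the number of grid points. -/
theorem reluRep_gridPoint {N : ℕ} {bx : ℝ} (hN : 0 < N) (hbx : 0 < bx)
    (y : (Fin 4 → Fin N) → ℝ) (hy : ∀ z, y z ^ 2 = 1) :
    ReluRep (Fin (N ^ 4 + 1)) (gridPoint N bx) (3000 * N ^ 4 / bx) y := by
  have hN' : (0 : ℝ) < N := by exact_mod_cast hN
  have hN1 : (1 : ℝ) ≤ N := by exact_mod_cast hN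
  set ω : ℂ := Complex.exp (2 * Real.pi * Complex.I / N) with hω
  have hprim : IsPrimitiveRoot ω N := Complex.isPrimitiveRoot_exp N hN.ne'
  have hω' : ω = Complex.exp (Complex.I * ((2 * Real.pi / N : ℝ) : ℂ)) := by
    rw [hω]; congr 1; push_cast; ring
  have hω1 : ‖ω‖ = 1 := by rw [hω', Complex.norm_exp_I_mul_ofReal]
  have hωsub : ‖ω - 1‖ ≤ 7 / N := by
    rw [hω']
    refine Real.norm_exp_I_mul_ofReal_sub_one_le.trans ?_
    rw [Real.norm_eq_abs, abs_of_pos (by positivity)]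
    gcongr
    linarith [Real.pi_lt_d2]
  obtain ⟨c, hc, hcy⟩ := exists_fourier_coeff hN hprim hω1 y hy
  have hcN : ∑ ξ, ‖c ξ‖ ≤ (N : ℝ) ^ 2 := by
    refine abs_le_of_sq_le_sq' (hc.trans_eq (by ring)) (by positivity) |>.2
  set g : (Fin 4 → Fin N) → ℕ → ℝ := fun ξ j => (c ξ * ω ^ j).re with hg
  have hg0 : ∀ ξ, |g ξ 0| ≤ ‖c ξ‖ := by
    intro ξ
    simpa [hg] using Complex.abs_re_le_norm (c ξ)
  have hg1 : ∀ ξ, |g ξ 1 - g ξ 0| ≤ 7 * ‖c ξ‖ := by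
    intro ξ
    have h1 : g ξ 1 - g ξ 0 = (c ξ * (ω - 1)).re := by
      simp only [hg, ← Complex.sub_re]
      congr 1
      ring
    rw [h1]
    refine (Complex.abs_re_le_norm _).trans ?_
    rw [norm_mul, mul_comm]
    gcongr
    refine hωsub.trans ?_
    rw [div_le_iff₀ hN']
    linarith
  have hg2 : ∀ ξ k, |g ξ (k + 2) - 2 * g ξ (k + 1) + g ξ k| ≤ 49 / N ^ 2 * ‖c ξ‖ := by
    intro ξ k
    have h1 : g ξ (k + 2) - 2 * g ξ (k + 1) + g ξ k = (c ξ * ω ^ k * (ω - 1) ^ 2).re := by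
      have : c ξ * ω ^ k * (ω - 1) ^ 2 =
          c ξ * ω ^ (k + 2) - (2 : ℝ) * (c ξ * ω ^ (k + 1)) + c ξ * ω ^ k := by
        push_cast; ring
      rw [this, Complex.add_re, Complex.sub_re, Complex.re_ofReal_mul]
    rw [h1]
    refine (Complex.abs_re_le_norm _).trans ?_
    rw [norm_mul, norm_mul, norm_pow, norm_pow, hω1, one_pow, mul_one, mul_comm]
    gcongr
    calc ‖ω - 1‖ ^ 2 ≤ (7 / N : ℝ) ^ 2 := by gcongr
      _ = _ := by ring
  let O := Option (Option (Fin (4 * N ^ 2)))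
  let τ : O → ℝ := fun o => o.elim 1 fun o => o.elim 0 fun k => -((k : ℕ) + 1 : ℝ)
  let σ : O → ℝ := fun o => o.elim 0 fun _ => 1
  let a : (Fin 4 → Fin N) × O → ℝ := fun κ => κ.2.elim (g κ.1 0) fun o =>
    o.elim (g κ.1 1 - g κ.1 0) fun k => g κ.1 (k + 2) - 2 * g κ.1 (k + 1) + g κ.1 k
  let w : (Fin 4 → Fin N) × O → Option (Fin 4) → ℝ := fun κ j =>
    j.elim (3 / bx * τ κ.2) fun i => 3 / bx * (N * σ κ.2 * (κ.1 i : ℕ))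
  have hτ : ∀ o, τ o ^ 2 ≤ 16 * (N : ℝ) ^ 4 := by
    intro o
    have h4 : (1 : ℝ) ≤ (N : ℝ) ^ 4 := one_le_pow₀ hN1
    match o with
    | none => simp only [τ, Option.elim]; linarith
    | some none => simp only [τ, Option.elim]; linarith
    | some (some k) =>
      simp only [τ, Option.elim, neg_sq]
      have : ((k : ℕ) : ℝ) + 1 ≤ 4 * (N : ℝ) ^ 2 := by exact_mod_cast k.2
      calc (((k : ℕ) : ℝ) + 1) ^ 2 ≤ (4 * (N : ℝ) ^ 2) ^ 2 := by gcongr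
        _ = _ := by ring
  have hσ : ∀ o, σ o ^ 2 ≤ 1 := by
    intro o
    match o with
    | none => simp [σ]
    | some _ => simp [σ]
  have hrep := reluRep_of_sum (x := gridPoint N bx) (v := y) (ρ := 14 * N ^ 2 / bx)
    (by positivity) a w ?_ ?_
  · refine (hrep.caratheodory).mono ?_ (by simp)
    have h1 : ∑ κ, |a κ| ≤ 204 * (N : ℝ) ^ 2 := by
      rw [Fintype.sum_prod_type]
      calc ∑ ξ, ∑ o, |a (ξ, o)| ≤ ∑ ξ, 204 * ‖c ξ‖ := by
            refine Finset.sum_le_sum fun ξ _ => ?_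
            rw [Fintype.sum_option, Fintype.sum_option]
            simp only [a, Option.elim]
            have h2 : ∑ k : Fin (4 * N ^ 2), |g ξ (k + 2) - 2 * g ξ (k + 1) + g ξ k| ≤
                196 * ‖c ξ‖ := by
              refine (Finset.sum_le_sum fun (k : Fin (4 * N ^ 2)) _ => hg2 ξ k).trans_eq ?_
              simp
              field_simp
              ring
            linarith [hg0 ξ, hg1 ξ]
        _ = 204 * ∑ ξ, ‖c ξ‖ := by rw [Finset.mul_sum]
        _ ≤ _ := by gcongr
    calc 14 * (N : ℝ) ^ 2 / bx * ∑ κ, |a κ| ≤ 14 * N ^ 2 / bx * (204 * N ^ 2) := by gcongr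
      _ = 2856 * N ^ 4 / bx := by ring
      _ ≤ _ := by gcongr; norm_num
  · intro κ
    rw [Fintype.sum_option]
    simp only [w, Option.elim]
    have h1 : ∀ i : Fin 4, (3 / bx * (N * σ κ.2 * (κ.1 i : ℕ))) ^ 2 ≤ (3 / bx) ^ 2 * N ^ 4 := by
      intro i
      have h2 : ((κ.1 i : ℕ) : ℝ) ≤ N := by exact_mod_cast (κ.1 i).2.le
      calc (3 / bx * (N * σ κ.2 * (κ.1 i : ℕ))) ^ 2
          = (3 / bx) ^ 2 * (N ^ 2 * σ κ.2 ^ 2 * (κ.1 i : ℕ) ^ 2) := by ring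
        _ ≤ (3 / bx) ^ 2 * (N ^ 2 * 1 * N ^ 2) := by gcongr; exact hσ _
        _ = _ := by ring
    calc _ ≤ (3 / bx) ^ 2 * (16 * N ^ 4) + ∑ i : Fin 4, (3 / bx) ^ 2 * (N : ℝ) ^ 4 := by
          rw [mul_pow]
          gcongr with i
          · exact hτ _
          · exact h1 i
      _ = 180 * N ^ 4 / bx ^ 2 := by simp; ring
      _ ≤ 196 * N ^ 4 / bx ^ 2 := by gcongr; norm_num
      _ = _ := by ring
  · intro z
    have hdot : ∀ κ, w κ ⬝ᵥ gridPoint N bx z =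
        τ κ.2 + σ κ.2 * ((∑ i, (κ.1 i : ℕ) * (z i : ℕ) : ℕ) : ℝ) := by
      intro κ
      simp only [dotProduct]
      rw [Fintype.sum_option]
      simp only [w, gridPoint, Option.elim]
      push_cast
      rw [Finset.mul_sum]
      congr 1
      · field_simp
      · refine Finset.sum_congr rfl fun i _ => ?_
        field_simp
    rw [hcy z, Fintype.sum_prod_type]
    refine Finset.sum_congr rfl fun ξ _ => ?_
    have hj : ∑ i, (ξ i : ℕ) * (z i : ℕ) ≤ 4 * N ^ 2 := by
      calc ∑ i, (ξ i : ℕ) * (z i : ℕ) ≤ ∑ i : Fin 4, N * N := by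
            gcongr with i
            · exact (ξ i).2.le
            · exact (z i).2.le
        _ = _ := by simp; ring
    simp only [hdot]
    generalize (∑ i, (ξ i : ℕ) * (z i : ℕ)) = j at hj
    have := eq_sum_second_diff (g ξ) hj
    change g ξ j = _
    rw [this, Fintype.sum_option, Fintype.sum_option]
    simp only [a, τ, σ, Option.elim]
    have hj0 : max (0 + 1 * (j : ℝ)) 0 = j := by rw [max_eq_left (by positivity)]; ring
    rw [hj0, zero_mul, add_zero, max_eq_left zero_le_one, mul_one, add_assoc]
    congr 2
    refine Finset.sum_congr rfl fun k _ => ?_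
    congr 2
    ring

/-- The point with code word `p k` and index `i` inside its group. -/
noncomputable def codePoint {q g r : ℕ} (p : Fin r ↪ (Fin q → Bool)) (bx : ℝ) (κ : Fin r × Fin g) :
    Fin q ⊕ Option (Fin g) → ℝ
  | .inl j => bx / 2 * (if p κ.1 j then 1 else -1) / Real.sqrt q
  | .inr none => bx / 2
  | .inr (some i) => bx / 2 * if i = κ.2 then 1 else 0

theorem sum_code_mul_le {q : ℕ} {s t : Fin q → Bool} (h : s ≠ t) :
    ∑ j, (if s j then (1 : ℝ) else -1) * (if t j then 1 else -1) ≤ q - 2 := by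
  obtain ⟨j, hj⟩ := Function.ne_iff.1 h
  have h1 : 2 ≤ ∑ j, (1 - (if s j then (1 : ℝ) else -1) * (if t j then 1 else -1)) := by
    refine le_trans ?_ (Finset.single_le_sum (f := fun j =>
      1 - (if s j then (1 : ℝ) else -1) * (if t j then 1 else -1)) (fun i _ => ?_)
      (Finset.mem_univ j))
    · revert hj
      cases s j <;> cases t j <;> norm_num
    · cases s i <;> cases t i <;> norm_num
  rw [Finset.sum_sub_distrib] at h1
  simp only [Finset.sum_const, Finset.card_univ, Fintype.card_fin, nsmul_eq_mul, mul_one] at h1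
  linarith

theorem codePoint_injective {q g r : ℕ} (hq : 0 < q) (p : Fin r ↪ (Fin q → Bool)) {bx : ℝ}
    (hbx : 0 < bx) : Function.Injective (codePoint (g := g) p bx) := by
  rintro ⟨k, i⟩ ⟨k', i'⟩ h
  have hq' : (0 : ℝ) < Real.sqrt q := Real.sqrt_pos.2 (by exact_mod_cast hq)
  have h1 : k = k' := by
    refine p.injective (funext fun j => ?_)
    have := congrFun h (.inl j)
    simp only [codePoint] at this
    field_simp at this
    revert this
    cases p k j <;> cases p k' j <;> norm_num
  have h2 : i = i' := by
    have := congrFun h (.inr (some i))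
    simp only [codePoint] at this
    by_contra hne
    simp [hne, hbx.ne'] at this
  rw [h1, h2]

theorem sum_codePoint_sq_le {q g r : ℕ} (hq : 0 < q) (p : Fin r ↪ (Fin q → Bool)) {bx : ℝ}
    (κ : Fin r × Fin g) : ∑ i, codePoint p bx κ i ^ 2 ≤ bx ^ 2 := by
  have hq' : (0 : ℝ) < q := by exact_mod_cast hq
  rw [Fintype.sum_sum_type, Fintype.sum_option]
  have h1 : ∀ j, codePoint p bx κ (.inl j) ^ 2 = (bx / 2) ^ 2 / q := by
    intro j
    simp only [codePoint, div_pow, mul_pow, Real.sq_sqrt hq'.le]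
    cases p κ.1 j <;> norm_num
  have h2 : ∑ i, codePoint p bx κ (.inr (some i)) ^ 2 = (bx / 2) ^ 2 := by
    simp [codePoint, ite_pow]
  rw [h2, Finset.sum_congr rfl fun j _ => h1 j]
  simp only [codePoint, Finset.sum_const, Finset.card_univ, Fintype.card_fin, nsmul_eq_mul]
  rw [mul_div_cancel₀ _ hq'.ne']
  nlinarith [sq_nonneg bx]

/-- One neuron for each code word realises an arbitrary labelling. -/
theorem reluRep_codePoint {q g r : ℕ} (hq : 0 < q) (p : Fin r ↪ (Fin q → Bool)) {bx h ε : ℝ}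
    (hbx : 0 < bx) (hh : 0 < h) (hqh : q * h ≤ 2) (hgh : g * h ^ 2 ≤ 1) (hε : 0 < ε)
    (y : Fin r × Fin g → Bool) :
    ReluRep (Fin r) (codePoint p bx) (8 * r * ε / (h * bx))
      (fun κ => if y κ then ε + ε else ε - ε) := by
  have hq' : (0 : ℝ) < q := by exact_mod_cast hq
  let sg : Bool → ℝ := fun t => if t then 1 else -1
  let w : Fin r → Fin q ⊕ Option (Fin g) → ℝ := fun k => Sum.elim (fun j => sg (p k j) / Real.sqrt q)
    (fun o => o.elim (-1) fun i => if y (k, i) then h else 0)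
  have hdot : ∀ k κ, w k ⬝ᵥ codePoint p bx κ =
      bx / 2 * ((∑ j, sg (p k j) * sg (p κ.1 j)) / q - 1 + if y (k, κ.2) then h else 0) := by
    intro k κ
    simp only [dotProduct]
    rw [Fintype.sum_sum_type, Fintype.sum_option]
    simp only [w, codePoint, Sum.elim_inl, Sum.elim_inr, Option.elim]
    have h1 : ∀ j, sg (p k j) / Real.sqrt q *
        (bx / 2 * (if p κ.1 j then 1 else -1) / Real.sqrt q) =
        bx / 2 * (sg (p k j) * sg (p κ.1 j) / q) := by
      intro j
      have : (q : ℝ) = Real.sqrt q * Real.sqrt q := (Real.mul_self_sqrt hq'.le).symm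
      rw [div_mul_div_comm, ← this]
      simp only [sg]
      ring
    rw [Finset.sum_congr rfl fun j _ => h1 j, ← Finset.mul_sum, ← Finset.sum_div]
    simp only [mul_ite, mul_one, mul_zero, Finset.sum_ite_eq',
      Finset.mem_univ, if_true]
    split_ifs <;> ring
  have hrep := reluRep_of_sum (x := codePoint p bx)
    (v := fun κ => if y κ then ε + ε else ε - ε) (ρ := 2)
    (by norm_num) (fun _ => 4 * ε / (h * bx)) w ?_ ?_
  · refine hrep.mono (le_of_eq ?_) le_rfl
    rw [abs_of_pos (by positivity)]
    simp
    ring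
  · intro k
    rw [Fintype.sum_sum_type, Fintype.sum_option]
    simp only [w, Sum.elim_inl, Sum.elim_inr, Option.elim]
    have h1 : ∀ j, (sg (p k j) / Real.sqrt q) ^ 2 = 1 / q := by
      intro j
      rw [div_pow, Real.sq_sqrt hq'.le]
      simp only [sg]
      cases p k j <;> norm_num
    have h2 : ∑ i, (if y (k, i) then h else 0) ^ 2 ≤ 1 := by
      refine le_trans ?_ hgh
      calc ∑ i, (if y (k, i) then h else 0) ^ 2 ≤ ∑ i : Fin g, h ^ 2 := by
            refine Finset.sum_le_sum fun i _ => ?_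
            split_ifs
            · exact le_rfl
            · simpa using sq_nonneg h
        _ = _ := by simp
    rw [Finset.sum_congr rfl fun j _ => h1 j]
    simp only [Finset.sum_const, Finset.card_univ, Fintype.card_fin, nsmul_eq_mul]
    rw [mul_one_div_cancel hq'.ne']
    linarith
  · rintro ⟨k, i⟩
    rw [Finset.sum_eq_single k]
    · rw [hdot]
      have h1 : ∑ j, sg (p k j) * sg (p k j) = q := by
        have : ∀ j, sg (p k j) * sg (p k j) = 1 := by
          intro j
          simp only [sg]
          cases p k j <;> norm_num
        simp [this]
      simp only
      rw [h1, div_self hq'.ne', sub_self (1 : ℝ), zero_add]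
      by_cases hy : y (k, i)
      · simp only [hy, if_true]
        rw [max_eq_left (by positivity)]
        field_simp
        norm_num
      · simp [hy]
    · intro k' _ hk'
      rw [hdot, max_eq_right, mul_zero]
      have h1 : ∑ j, sg (p k' j) * sg (p k j) ≤ q - 2 :=
        sum_code_mul_le fun h => hk' (p.injective h)
      have h2 : (if y (k', i) then h else 0) ≤ 2 / q := by
        have h3 : h ≤ 2 / q := by rw [le_div_iff₀ hq']; linarith
        split_ifs
        · exact h3
        · positivity
      have h4 : (∑ j, sg (p k' j) * sg (p k j)) / q ≤ 1 - 2 / q := by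
        rw [div_le_iff₀ hq', sub_mul, one_mul, div_mul_cancel₀ _ hq'.ne']
        exact h1
      refine mul_nonpos_of_nonneg_of_nonpos (by positivity) ?_
      simp only
      linarith
    · simp

theorem four_mul_bias_sq_le {d n : ℕ} (hn : 0 < n) (hd : 36 ≤ d) {B bx κ : ℝ} (hbx : 0 < bx)
    (hκ : bx / 3 ≤ κ) :
    4 * n * (B * bx / Real.sqrt ((d : ℝ) * n)) ^ 2 ≤ κ ^ 2 * B ^ 2 := by
  have hn' : (0 : ℝ) < n := by exact_mod_cast hn
  have hd' : (36 : ℝ) ≤ d := by exact_mod_cast hd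
  have hd0 : (0 : ℝ) < d := by linarith
  rw [div_pow, Real.sq_sqrt (by positivity)]
  calc 4 * n * ((B * bx) ^ 2 / (d * n)) = 4 * (B * bx) ^ 2 / d := by field_simp
    _ ≤ 4 * (B * bx) ^ 2 / 36 := by gcongr
    _ = (bx / 3) ^ 2 * B ^ 2 := by ring
    _ ≤ κ ^ 2 * B ^ 2 := by gcongr

/-- Shattering in high dimension: `r` groups of `d - ⌊√d⌋ - 1` points each. -/
theorem exists_shatters_code {b B bx ε : ℝ} {n d r : ℕ} (hb : 0 < b) (hB : 0 < B) (hbx : 0 < bx)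
    (hε : 0 < ε) (hn : 0 < n) (hd : 36 ≤ d) (hrn : r ≤ n) (hr : r ≤ 2 ^ d.sqrt)
    (hcost : 16 * r * ε * Real.sqrt d ≤ b * B * bx) :
    ∃ z : Fin (r * (d - d.sqrt - 1)) → EuclideanSpace ℝ (Fin d),
      Function.Injective z ∧ (∀ i, ‖z i‖ ≤ bx) ∧ ShattersWithMargin
        (frobClass (biasedReLU (B * bx / Real.sqrt ((d : ℝ) * n))) b B n d) z ε := by
  set q := d.sqrt with hq
  have hq0 : 0 < q := Nat.sqrt_pos.2 (by omega)
  have hqd : q * q ≤ d := Nat.sqrt_le d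
  have hq6 : 6 ≤ q := Nat.le_sqrt.2 (by omega)
  have hq1 : q + 1 ≤ d := by nlinarith
  have hd0 : (0 : ℝ) < d := by exact_mod_cast (by omega : 0 < d)
  have hsd : 0 < Real.sqrt d := Real.sqrt_pos.2 hd0
  have hqs : (q : ℝ) ≤ Real.sqrt d := Real.le_sqrt_of_sq_le (by rw [sq]; exact_mod_cast hqd)
  obtain ⟨p⟩ : Nonempty (Fin r ↪ (Fin q → Bool)) :=
    Function.Embedding.nonempty_of_card_le (by simpa using hr)
  have hmain := shatters_of_reluRep (P := Fin r × Fin (d - q - 1)) (K := Fin r) (d := d) (n := n)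
    (x := codePoint p bx) (i₀ := .inr none) (κ := bx / 2) (b := b) (B := B)
    (β := B * bx / Real.sqrt ((d : ℝ) * n)) (bx := bx) (ε := ε) (s := ε)
    (by simp; omega) (by simpa using hrn) (codePoint_injective hq0 p hbx) (by positivity)
    (fun _ => rfl) hb hB hbx.le (sum_codePoint_sq_le hq0 p)
    (four_mul_bias_sq_le hn hd hbx (by linarith))
    (fun y => (reluRep_codePoint hq0 p hbx (h := 1 / Real.sqrt d) (by positivity) ?_ ?_ hε y).mono
      ?_ le_rfl)
  · rwa [Fintype.card_prod, Fintype.card_fin, Fintype.card_fin] at hmain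
  · rw [mul_one_div, div_le_iff₀ hsd]
    linarith
  · rw [div_pow, one_pow, Real.sq_sqrt hd0.le, mul_one_div, div_le_one hd0]
    exact_mod_cast (by omega : d - q - 1 ≤ d)
  · rw [div_le_iff₀ (by positivity)]
    calc 8 * r * ε = 16 * r * ε * Real.sqrt d / (2 * Real.sqrt d) := by field_simp; ring
      _ ≤ b * B * bx / (2 * Real.sqrt d) := by gcongr
      _ = b * B / 2 * (1 / Real.sqrt d * bx) := by field_simp

/-- Shattering in low dimension: the points of a four-dimensional grid. -/
theorem exists_shatters_grid {b B bx ε : ℝ} {n d N : ℕ} (hb : 0 < b) (hB : 0 < B) (hbx : 0 < bx)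
    (hε : 0 < ε) (hd : 36 ≤ d) (hN : 0 < N) (hNn : N ^ 4 + 1 ≤ n)
    (hcost : 6000 * ε * N ^ 4 ≤ b * B * bx) :
    ∃ z : Fin (N ^ 4) → EuclideanSpace ℝ (Fin d),
      Function.Injective z ∧ (∀ i, ‖z i‖ ≤ bx) ∧ ShattersWithMargin
        (frobClass (biasedReLU (B * bx / Real.sqrt ((d : ℝ) * n))) b B n d) z ε := by
  have hmain := shatters_of_reluRep (P := Fin 4 → Fin N) (K := Fin (N ^ 4 + 1)) (d := d) (n := n)
    (x := gridPoint N bx) (i₀ := none) (κ := bx / 3) (b := b) (B := B)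
    (β := B * bx / Real.sqrt ((d : ℝ) * n)) (bx := bx) (ε := ε) (s := 0)
    (by simp; omega) (by simpa using hNn) (gridPoint_injective hN hbx) (by positivity)
    (fun _ => rfl) hb hB hbx.le (sum_gridPoint_sq_le hN)
    (four_mul_bias_sq_le (by omega) hd hbx le_rfl) ?_
  · rwa [Fintype.card_fun, Fintype.card_fin, Fintype.card_fin] at hmain
  · intro y
    have h := ((reluRep_gridPoint hN hbx (fun z => if y z then 1 else -1)
      (fun z => by split_ifs <;> norm_num)).const_mul hε.le).mono
      (L := Fin (N ^ 4 + 1)) (T' := b * B / 2) ?_ le_rfl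
    · convert h using 2 with z
      split_ifs <;> ring
    · rw [← mul_div_assoc, div_le_iff₀ hbx]
      linarith

theorem one_le_logScale {d n : ℕ} {b B bx ε : ℝ} (hb : 0 < b) (hB : 0 < B) (hbx : 0 < bx)
    (hε : 0 < ε) (hn : 0 < n) : 1 ≤ logScale d n b B bx ε := by
  have hn' : (1 : ℝ) ≤ n := by exact_mod_cast hn
  have h1 : 0 < 1 / ε := by positivity
  have h2 : (0 : ℝ) ≤ d := by positivity
  refine (Real.le_log_iff_exp_le (by positivity)).2 ?_
  linarith [Real.exp_one_lt_d9]

theorem le_exp_logScale {d n : ℕ} {b B bx ε : ℝ} (hb : 0 < b) (hB : 0 < B) (hbx : 0 < bx)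
    (hε : 0 < ε) : (n : ℝ) ≤ Real.exp (logScale d n b B bx ε) := by
  have h1 : 0 < 1 / ε := by positivity
  have h2 : (0 : ℝ) ≤ d := by positivity
  rw [logScale, Real.exp_log (by positivity)]
  linarith

theorem theorem3 :
    ∃ (C₁ C₂ c : ℝ) (k₁ k₂ d₀ : ℕ), 0 < C₁ ∧ 0 < C₂ ∧ 0 < c ∧
      ∀ (b B bx ε : ℝ) (n d : ℕ), 0 < b → 0 < B → 0 < bx → 0 < ε → 0 < n → d₀ ≤ d →
        c * d < shatterBound C₁ k₁ d n b B bx ε →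
        ∃ β : ℝ, 0 ≤ β ∧
          β ≤ C₂ * logScale d n b B bx ε ^ k₂ * (B * bx / Real.sqrt ((d : ℝ) * n)) ∧
          ∃ (m : ℕ) (x : Fin m → EuclideanSpace ℝ (Fin d)),
            shatterBound C₁ k₁ d n b B bx ε ≤ m ∧
            Function.Injective x ∧
            (∀ i, ‖x i‖ ≤ bx) ∧
            ShattersWithMargin (frobClass (biasedReLU β) b B n d) x ε := by
  refine ⟨10 ^ 6, 1, 1, 2, 0, 36, by norm_num, by norm_num, by norm_num, ?_⟩
  intro b B bx ε n d hb hB hbx hε hn hd hM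
  refine ⟨B * bx / Real.sqrt ((d : ℝ) * n), by positivity, by simp, ?_⟩
  have hΛ := one_le_logScale (d := d) hb hB hbx hε hn
  have hnΛ := le_exp_logScale (d := d) (n := n) hb hB hbx hε
  set Λ := logScale d n b B bx ε with hΛdef
  set M := shatterBound (10 ^ 6) 2 d n b B bx ε with hMdef
  have hd' : (36 : ℝ) ≤ d := by exact_mod_cast hd
  have hd0 : (0 : ℝ) < d := by linarith
  have hn0 : (0 : ℝ) < n := by exact_mod_cast hn
  have hMd : (d : ℝ) < M := by linarith
  have hM0 : 0 < M := hd0.trans hMd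
  have hΛ2 : 1 ≤ Λ ^ 2 := one_le_pow₀ hΛ
  have hsd : 0 < Real.sqrt d := Real.sqrt_pos.2 hd0
  have hsd2 : Real.sqrt d * Real.sqrt d = d := Real.mul_self_sqrt hd0.le
  have hMmin : M * (10 ^ 6 * Λ ^ 2) = min ((n : ℝ) * d) (b * B * bx / ε * Real.sqrt d) := by
    rw [hMdef, shatterBound, ← hΛdef]
    exact div_mul_cancel₀ _ (by positivity)
  have hM1 : M * (10 ^ 6 * Λ ^ 2) ≤ n * d := hMmin.trans_le (min_le_left _ _)
  have hM2 : M * (10 ^ 6 * Λ ^ 2) * ε ≤ b * B * bx * Real.sqrt d := by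
    have := hMmin.trans_le (min_le_right _ _)
    rw [div_mul_eq_mul_div, le_div_iff₀ hε] at this
    exact this
  have hMΛ : M * 10 ^ 6 ≤ M * (10 ^ 6 * Λ ^ 2) := by
    rw [← mul_assoc]
    exact le_mul_of_one_le_right (by positivity) hΛ2
  rcases le_or_gt (3 * Λ) (Real.sqrt d) with hcase | hcase
  · have hq : Real.sqrt d < d.sqrt + 1 := by
      refine (Real.sqrt_lt' (by positivity)).2 ?_
      rw [sq]
      exact_mod_cast Nat.lt_succ_sqrt d
    have hg : (d : ℝ) / 2 ≤ ((d - d.sqrt - 1 : ℕ) : ℝ) := by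
      have h1 : d.sqrt * d.sqrt ≤ d := Nat.sqrt_le d
      have h2 : 6 ≤ d.sqrt := Nat.le_sqrt.2 (by omega)
      have h3 : 2 * d.sqrt + 2 ≤ d := by nlinarith
      have h4 : (d : ℝ) ≤ 2 * ((d - d.sqrt - 1 : ℕ) : ℝ) := by
        exact_mod_cast (by omega : d ≤ 2 * (d - d.sqrt - 1))
      linarith
    set g := d - d.sqrt - 1 with hgdef
    have hg0 : (0 : ℝ) < g := by linarith
    set r := ⌈M / g⌉₊ with hr
    have hrM : M ≤ r * g := (div_le_iff₀ hg0).1 (Nat.le_ceil _)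
    have hrd : r * (d : ℝ) ≤ 3 * M := by
      have h1 : (r : ℝ) < M / g + 1 := Nat.ceil_lt_add_one (by positivity)
      have h2 : M / g ≤ 2 * M / d := by
        rw [div_le_div_iff₀ hg0 hd0]
        nlinarith
      calc r * (d : ℝ) ≤ (2 * M / d + 1) * d := by gcongr; linarith
        _ = 2 * M + d := by field_simp
        _ ≤ 3 * M := by linarith
    have hrn : r ≤ n := by
      have : (r : ℝ) * d ≤ n * d := by linarith
      exact_mod_cast le_of_mul_le_mul_right this hd0
    have hr2 : r ≤ 2 ^ d.sqrt := by
      have h1 : (n : ℝ) ≤ 2 ^ d.sqrt := by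
        refine hnΛ.trans ?_
        rw [← Real.rpow_natCast, Real.rpow_def_of_pos two_pos]
        refine Real.exp_le_exp.2 ?_
        nlinarith [Real.log_two_gt_d9]
      exact hrn.trans (by exact_mod_cast h1)
    obtain ⟨z, hz⟩ := exists_shatters_code hb hB hbx hε hn hd hrn hr2 (by
      refine le_of_mul_le_mul_right ?_ hsd
      calc 16 * r * ε * Real.sqrt d * Real.sqrt d = 16 * ε * (r * d) := by
            rw [mul_assoc, hsd2]; ring
        _ ≤ 16 * ε * (3 * M) := by gcongr
        _ = 48 * (M * ε) := by ring
        _ ≤ M * 10 ^ 6 * ε := by nlinarith [mul_pos hM0 hε]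
        _ ≤ M * (10 ^ 6 * Λ ^ 2) * ε := by gcongr
        _ ≤ _ := hM2)
    exact ⟨_, z, by rw [← hgdef]; exact_mod_cast hrM, hz⟩
  · have hd9 : (d : ℝ) ≤ 9 * Λ ^ 2 := by
      rw [← hsd2]
      nlinarith
    have hMn : M * 10 ^ 6 ≤ 9 * n := by
      refine le_of_mul_le_mul_right ?_ (by positivity : 0 < Λ ^ 2)
      nlinarith
    have hMb : M * 10 ^ 6 * ε ≤ 3 * (b * B * bx) := by
      refine le_of_mul_le_mul_right ?_ (by positivity : 0 < Λ ^ 2)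
      calc M * 10 ^ 6 * ε * Λ ^ 2 = M * (10 ^ 6 * Λ ^ 2) * ε := by ring
        _ ≤ b * B * bx * Real.sqrt d := hM2
        _ ≤ b * B * bx * (3 * Λ ^ 2) := by
            gcongr
            nlinarith
        _ = _ := by ring
    set t := Real.sqrt (Real.sqrt M) with ht
    have ht4 : t ^ 4 = M := by
      rw [show 4 = 2 * 2 from rfl, pow_mul, ht, Real.sq_sqrt (Real.sqrt_nonneg _),
        Real.sq_sqrt hM0.le]
    have ht1 : 1 ≤ t := Real.one_le_sqrt.2 (Real.one_le_sqrt.2 (by linarith))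
    set N := ⌈t⌉₊ with hN
    have htN : t ≤ N := Nat.le_ceil _
    have hN0 : 0 < N := Nat.ceil_pos.2 (by linarith)
    have hNt : (N : ℝ) ≤ 2 * t := by
      have := Nat.ceil_lt_add_one (by linarith : 0 ≤ t)
      linarith
    have hMN : M ≤ (N : ℝ) ^ 4 := by rw [← ht4]; gcongr
    have hNM : (N : ℝ) ^ 4 ≤ 16 * M := by
      calc (N : ℝ) ^ 4 ≤ (2 * t) ^ 4 := by gcongr
        _ = 16 * M := by rw [mul_pow, ht4]; norm_num
    obtain ⟨z, hz⟩ := exists_shatters_grid (n := n) hb hB hbx hε hd hN0 (by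
      have : (N : ℝ) ^ 4 + 1 ≤ n := by linarith
      exact_mod_cast this) (by
      have : 6000 * ε * (N : ℝ) ^ 4 ≤ 6000 * ε * (16 * M) := by gcongr
      have := mul_pos hM0 hε
      nlinarith)
    exact ⟨_, z, by exact_mod_cast hMN, hz⟩
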